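/- Let $G$ be a finite non-abelian group with center $Z(G)$. For $g\in G$ write $g^G$ for its conjugacy class. The CCC-graph (commuting conjugacy class graph) $\Gamma_G$ is the simple graph whose vertices are the conjugacy classes $g^G$ with $g\in G\setminus Z(G)$, two distinct classes being adjacent if some element of the first commutes with some element of the second. For a finite simple graph $\mathcal G$ with vertices $v_1,\dots,v_N$, let $\mathrm{CN}(\mathcal G)$ be the $N\times N$ matrix whose $(i,j)$ entry is the number of common neighbors of $v_i$ and $v_j$ if $i\neq j$, and $0$ if $i=j$; let $\mathrm{CNRS}(\mathcal G)$ be the diagonal matrix of row sums of $\mathrm{CN}(\mathcal G)$. The graph $\mathcal G$ is called CNL-integral (respectively CNSL-integral) if all eigenvalues of $\mathrm{CNRS}(\mathcal G)-\mathrm{CN}(\mathcal G)$ (respectively of $\mathrm{CNRS}(\mathcal G)+\mathrm{CN}(\mathcal G)$) are integers. Then $\Gamma_G$ is both CNL-integral and CNSL-integral if at least one of the following holds: 1. $G/Z(G)\cong \mathbb Z_p\times\mathbb Z_p$ for some prime $p$; 2. $G/Z(G)\cong D_{2n}$, the dihedral group of order $2n$, for some $n\ge 3$; 3. $G$ is isomorphic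 to one of the following groups: - $D_{2n}=\langle x,y : x^n=y^2=1,\ yxy^{-1}=x^{-1}\rangle$ with $n\ge 3$; - $T_{4n}=\langle x,y : x^{2n}=1,\ x^n=y^2,\ y^{-1}xy=x^{-1}\rangle$ with $n\ge 2$; - $U_{6n}=\langle x,y : x^{2n}=y^3=1,\ x^{-1}yx=y^{-1}\rangle$ with $n\ge 2$; - $U_{(n,m)}=\langle x,y : x^{2n}=y^m=1,\ x^{-1}yx=y^{-1}\rangle$ with $n\ge 2$, $m\ge 2$; - $SD_{8n}=\langle x,y : x^{4n}=y^2=1,\ yxy=x^{2n-1}\rangle$ with $n\ge 2$; - $V_{8n}=\langle x,y : x^{2n}=y^4=1,\ yx=x^{-1}y^{-1},\ y^{-1}x=x^{-1}y\rangle$ with $n\ge 2$. -/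

import Mathlib

section CommonNeighborhood

variable {V : Type*} [Fintype V]

open Classical in
/-- The common neighborhood matrix of a finite simple graph: the `(i, j)` entry is the number of
vertices adjacent to both `i` and `j` when `i ≠ j`, and `0` when `i = j`. (A common neighbor of
`i` and `j` in a simple graph is automatically different from `i` and from `j`.) -/
noncomputable def CN (Γ : SimpleGraph V) : Matrix V V ℤ :=
  Matrix.of fun i j => if i ≠ j then ((Γ.commonNeighbors i j).ncard : ℤ) else 0

open Classical in
/-- The diagonal matrix of the row sums of the common neighborhood matrix. -/
noncomputable def CNRS (Γ : SimpleGraph V) : Matrix V V ℤ :=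
  Matrix.diagonal fun i => ∑ k, CN Γ i k

/-- The common neighborhood Laplacian matrix. -/
noncomputable def CNL (Γ : SimpleGraph V) : Matrix V V ℤ := CNRS Γ - CN Γ

/-- The common neighborhood signless Laplacian matrix. -/
noncomputable def CNSL (Γ : SimpleGraph V) : Matrix V V ℤ := CNRS Γ + CN Γ

open Classical in
/-- The spectrum, with multiplicities, of a square integer matrix: the multiset of its complex
eigenvalues. -/
noncomputable def specWithMult (A : Matrix V V ℤ) : Multiset ℂ :=
  (A.map (Int.cast : ℤ → ℂ)).charpoly.roots

/-- The CNL-spectrum of a graph. -/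
noncomputable def CNLSpec (Γ : SimpleGraph V) : Multiset ℂ := specWithMult (CNL Γ)

/-- The CNSL-spectrum of a graph. -/
noncomputable def CNSLSpec (Γ : SimpleGraph V) : Multiset ℂ := specWithMult (CNSL Γ)

/-- A graph is CNL-integral if its CNL-spectrum contains only integers. -/
def IsCNLIntegral (Γ : SimpleGraph V) : Prop := ∀ α ∈ CNLSpec Γ, ∃ k : ℤ, α = (k : ℂ)

/-- A graph is CNSL-integral if its CNSL-spectrum contains only integers. -/
def IsCNSLIntegral (Γ : SimpleGraph V) : Prop := ∀ β ∈ CNSLSpec Γ, ∃ k : ℤ, β = (k : ℂ)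

end CommonNeighborhood

section CCC

/-- The conjugacy classes of the non-central elements of a group. -/
def CCCVertex (G : Type*) [Group G] : Type _ :=
  {C : ConjClasses G // ∃ x : G, x ∉ Subgroup.center G ∧ ConjClasses.mk x = C}

instance CCCVertex.instFinite (G : Type*) [Group G] [Finite G] : Finite (CCCVertex G) :=
  haveI : Finite (ConjClasses G) := Quotient.finite _
  Subtype.finite

noncomputable instance CCCVertex.instFintype (G : Type*) [Group G] [Finite G] :
    Fintype (CCCVertex G) :=
  Fintype.ofFinite _

/-- The commuting conjugacy class graph of a group: two distinct classes of non-central elements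
are adjacent if some element of the first commutes with some element of the second. -/
def CCCGraph (G : Type*) [Group G] : SimpleGraph (CCCVertex G) where
  Adj C D := C ≠ D ∧ ∃ x ∈ C.1.carrier, ∃ y ∈ D.1.carrier, x * y = y * x
  symm := ⟨fun _ _ ⟨hne, x, hx, y, hy, h⟩ => ⟨hne.symm, y, hy, x, hx, h.symm⟩⟩
  loopless := ⟨fun _ h => h.1 rfl⟩

end CCC

section Families

/-- The first generator of the free group on two letters. -/
def genX : FreeGroup (Fin 2) := FreeGroup.of 0

/-- The second generator of the free group on two letters. -/
def genY : FreeGroup (Fin 2) := FreeGroup.of 1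

/-- `U_{6n} = ⟨x, y : x^{2n} = y^3 = 1, x⁻¹ y x = y⁻¹⟩`. -/
abbrev GroupUSix (n : ℕ) : Type :=
  PresentedGroup
    ({genX ^ (2 * n), genY ^ 3, genX⁻¹ * genY * genX * (genY⁻¹)⁻¹} : Set (FreeGroup (Fin 2)))

/-- `U_{(n,m)} = ⟨x, y : x^{2n} = y^m = 1, x⁻¹ y x = y⁻¹⟩`. -/
abbrev GroupU (n m : ℕ) : Type :=
  PresentedGroup
    ({genX ^ (2 * n), genY ^ m, genX⁻¹ * genY * genX * (genY⁻¹)⁻¹} : Set (FreeGroup (Fin 2)))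

/-- `SD_{8n} = ⟨x, y : x^{4n} = y^2 = 1, y x y = x^{2n-1}⟩`; the exponent is an integer. -/
abbrev GroupSD (n : ℕ) : Type :=
  PresentedGroup
    ({genX ^ (4 * n), genY ^ 2, genY * genX * genY * (genX ^ (2 * (n : ℤ) - 1))⁻¹} :
      Set (FreeGroup (Fin 2)))

/-- `V_{8n} = ⟨x, y : x^{2n} = y^4 = 1, y x = x⁻¹ y⁻¹, y⁻¹ x = x⁻¹ y⟩`. -/
abbrev GroupV (n : ℕ) : Type :=
  PresentedGroup
    ({genX ^ (2 * n), genY ^ 4, genY * genX * (genX⁻¹ * genY⁻¹)⁻¹,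
      genY⁻¹ * genX * (genX⁻¹ * genY)⁻¹} : Set (FreeGroup (Fin 2)))

end Families

/-!
If the centralizers of the non-central elements of `G` are abelian, commutation is a transitive
relation on these elements, so the CCC-graph is a disjoint union of complete graphs. Its matrices
`CNL` and `CNSL` are then block diagonal with blocks `p I + q J`, where `J` is the all-ones matrix
and `p`, `q` are integers; on a block of size `m` the eigenvalues are `p` and `p + q m`.

Centralizers of non-central elements are abelian in any group with an abelian normal subgroup `A`
whose index is prime or `1`. In cases 1 and 2, `A` is the preimage of a cyclic normal subgroup of
`G / Z(G)` of prime index. In case 3 it has index dividing `2` and is generated by `x` for `D`, `T`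
and `SD`, by `x²` and `y` for `U`, and by `x` and `y²` for `V`.
-/

section FiberBlockMatrix

open Finset Matrix

variable {V K R : Type*} [DecidableEq V] [DecidableEq K]

/-- The matrix which vanishes off the diagonal blocks cut out by the fibers of a coloring `c` of the
index set, and whose block on the fiber of `k` is the constant `q k` plus the scalar `p k`. All the
matrices attached below to a disjoint union of complete graphs have this shape. -/
def fiberBlockMatrix [AddZeroClass R] (c : V → K) (p q : K → R) : Matrix V V R :=
  diagonal (fun i => p (c i)) + of fun i j => if c j = c i then q (c i) else 0

theorem fiberBlockMatrix_map {S F : Type*} [AddZeroClass R] [AddZeroClass S] [FunLike F R S]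
    [AddMonoidHomClass F R S] (f : F) (c : V → K) (p q : K → R) :
    (fiberBlockMatrix c p q).map f = fiberBlockMatrix c (f ∘ p) (f ∘ q) := by
  ext i j
  by_cases hij : i = j <;> simp [fiberBlockMatrix, hij, apply_ite f]

variable [Fintype V]

theorem fiberBlockMatrix_mulVec [NonUnitalNonAssocSemiring R] (c : V → K) (p q : K → R) (v : V → R)
    (i : V) :
    (fiberBlockMatrix c p q *ᵥ v) i = p (c i) * v i + q (c i) * ∑ j with c j = c i, v j := by
  rw [fiberBlockMatrix, add_mulVec, Pi.add_apply, mulVec_diagonal, mul_sum, sum_filter]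
  simp only [mulVec, dotProduct, of_apply, ite_mul, zero_mul]

theorem sum_fiberBlockMatrix [NonAssocSemiring R] (c : V → K) (p q : K → R) (i : V) :
    ∑ j, fiberBlockMatrix c p q i j = p (c i) + q (c i) * #{j | c j = c i} := by
  simpa [mulVec, dotProduct] using fiberBlockMatrix_mulVec c p q 1 i

/-- An eigenvector is an eigenvector for `p k` wherever its sum over the fiber of `k` vanishes; on
another fiber, summing the eigenvalue equation shows that the eigenvalue is the row sum. -/
theorem eigenvalue_fiberBlockMatrix [CommRing R] [NoZeroDivisors R] {c : V → K} {p q : K → R}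
    {α : R} {v : V → R} (hv : v ≠ 0) (h : fiberBlockMatrix c p q *ᵥ v = α • v) :
    ∃ k, α = p k ∨ α = p k + q k * #{j | c j = k} := by
  have heq (i : V) : α * v i = p (c i) * v i + q (c i) * ∑ j with c j = c i, v j := by
    rw [← fiberBlockMatrix_mulVec, h, Pi.smul_apply, smul_eq_mul]
  obtain ⟨i, hi⟩ := Function.ne_iff.mp hv
  refine ⟨c i, ?_⟩
  by_cases hsum : ∑ j with c j = c i, v j = 0
  · exact .inl (mul_right_cancel₀ hi (by rw [heq i, hsum, mul_zero, add_zero]))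
  · refine .inr (mul_right_cancel₀ hsum ?_)
    calc α * ∑ j with c j = c i, v j
        = ∑ j with c j = c i, (p (c i) * v j + q (c i) * ∑ l with c l = c i, v l) := by
          rw [mul_sum]
          refine sum_congr rfl fun j hj => ?_
          rw [heq j, (mem_filter.mp hj).2]
      _ = (p (c i) + q (c i) * #{j | c j = c i}) * ∑ j with c j = c i, v j := by
          rw [sum_add_distrib, ← mul_sum, sum_const, nsmul_eq_mul]
          ring

end FiberBlockMatrix

section IntegerSpectrum

open Finset Matrix

variable {V : Type*} [Fintype V]

theorem exists_mulVec_eq_smul_of_mem_specWithMult {A : Matrix V V ℤ} {α : ℂ}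
    (hα : α ∈ specWithMult A) : ∃ v ≠ 0, A.map (Int.cast : ℤ → ℂ) *ᵥ v = α • v := by
  classical
  have hroot := Polynomial.isRoot_of_mem_roots hα
  rw [Polynomial.IsRoot, eval_charpoly] at hroot
  obtain ⟨v, hv, hαv⟩ := exists_mulVec_eq_zero_iff.mpr hroot
  refine ⟨v, hv, ?_⟩
  rw [sub_mulVec, sub_eq_zero] at hαv
  simpa using hαv.symm

theorem exists_int_of_mem_specWithMult_fiberBlockMatrix [DecidableEq V] {K : Type*} [DecidableEq K]
    (c : V → K) (p q : K → ℤ) :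
    ∀ α ∈ specWithMult (fiberBlockMatrix c p q), ∃ k : ℤ, α = k := by
  intro α hα
  obtain ⟨v, hv, hαv⟩ := exists_mulVec_eq_smul_of_mem_specWithMult hα
  have hmap := fiberBlockMatrix_map (Int.castRingHom ℂ) c p q
  obtain ⟨k, rfl | rfl⟩ := eigenvalue_fiberBlockMatrix hv (hmap ▸ hαv)
  · exact ⟨p k, rfl⟩
  · exact ⟨p k + q k * #{j | c j = k}, by simp⟩

end IntegerSpectrum

section ClusterGraph

open Finset Matrix

variable {V : Type*} {Γ : SimpleGraph V}

/-- A cluster graph is a disjoint union of complete graphs: all its connected components are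
complete. -/
def IsClusterGraph (Γ : SimpleGraph V) : Prop :=
  ∀ ⦃a b⦄, Γ.Reachable a b → a ≠ b → Γ.Adj a b

theorem isClusterGraph_of_adj_trans
    (h : ∀ ⦃a b c⦄, Γ.Adj a b → Γ.Adj b c → a ≠ c → Γ.Adj a c) : IsClusterGraph Γ := by
  rintro a b ⟨w⟩
  induction w with
  | nil => exact fun hne => absurd rfl hne
  | @cons a b c hab _ ih =>
    intro hac
    obtain rfl | hbc := eq_or_ne b c
    · exact hab
    · exact h hab (ih hbc) hac

namespace IsClusterGraph

theorem adj_iff (hΓ : IsClusterGraph Γ) {a b : V} :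
    Γ.Adj a b ↔ Γ.connectedComponentMk b = Γ.connectedComponentMk a ∧ b ≠ a := by
  rw [SimpleGraph.ConnectedComponent.eq]
  exact ⟨fun h => ⟨h.symm.reachable, h.ne'⟩, fun h => (hΓ h.1 h.2).symm⟩

open Classical in
theorem ncard_commonNeighbors [Finite V] (hΓ : IsClusterGraph Γ) {i j : V} (hij : i ≠ j) :
    ((Γ.commonNeighbors i j).ncard : ℤ) =
      if Γ.connectedComponentMk j = Γ.connectedComponentMk i then
        ((Γ.connectedComponentMk i).supp.ncard : ℤ) - 2 else 0 := by
  split_ifs with h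
  · have hset : Γ.commonNeighbors i j = (Γ.connectedComponentMk i).supp \ {i, j} := by
      ext k
      simp only [SimpleGraph.mem_commonNeighbors, hΓ.adj_iff, h, Set.mem_sdiff, Set.mem_insert_iff,
        Set.mem_singleton_iff, SimpleGraph.ConnectedComponent.mem_supp_iff]
      tauto
    have hsub : {i, j} ⊆ (Γ.connectedComponentMk i).supp := by
      rintro k (rfl | rfl)
      exacts [rfl, h]
    have hcard := Set.ncard_sdiff_add_ncard_of_subset hsub
    rw [← hset, Set.ncard_pair hij] at hcard
    omega
  · have hset : Γ.commonNeighbors i j = ∅ := by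
      refine Set.eq_empty_of_forall_notMem fun k hk => h ?_
      rw [SimpleGraph.mem_commonNeighbors, hΓ.adj_iff, hΓ.adj_iff] at hk
      exact hk.2.1.symm.trans hk.1.1
    simp [hset]

open Classical in
theorem CN_eq_fiberBlockMatrix [Finite V] (hΓ : IsClusterGraph Γ) :
    CN Γ = fiberBlockMatrix Γ.connectedComponentMk (fun C => 2 - (C.supp.ncard : ℤ))
      (fun C => C.supp.ncard - 2) := by
  ext i j
  rw [CN, of_apply, fiberBlockMatrix, Matrix.add_apply, of_apply]
  obtain rfl | hij := eq_or_ne i j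
  · simp
  · simp [hij, hΓ.ncard_commonNeighbors hij]

variable [Fintype V]

open Classical in
theorem sum_CN (hΓ : IsClusterGraph Γ) (i : V) :
    ∑ j, CN Γ i j = ((Γ.connectedComponentMk i).supp.ncard - 1 : ℤ) *
      ((Γ.connectedComponentMk i).supp.ncard - 2) := by
  have hcard : #{j | Γ.connectedComponentMk j = Γ.connectedComponentMk i} =
      (Γ.connectedComponentMk i).supp.ncard := by
    rw [← Set.ncard_coe_finset, coe_filter_univ]
    rfl
  rw [hΓ.CN_eq_fiberBlockMatrix, sum_fiberBlockMatrix, hcard]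
  ring

open Classical in
theorem CNL_eq_fiberBlockMatrix (hΓ : IsClusterGraph Γ) :
    CNL Γ = fiberBlockMatrix Γ.connectedComponentMk
      (fun C => (C.supp.ncard : ℤ) * (C.supp.ncard - 2)) (fun C => 2 - C.supp.ncard) := by
  rw [CNL, CNRS, funext hΓ.sum_CN, hΓ.CN_eq_fiberBlockMatrix]
  ext i j
  simp only [fiberBlockMatrix, Matrix.sub_apply, Matrix.add_apply, diagonal_apply, of_apply]
  split_ifs <;> ring

open Classical in
theorem CNSL_eq_fiberBlockMatrix (hΓ : IsClusterGraph Γ) :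
    CNSL Γ = fiberBlockMatrix Γ.connectedComponentMk
      (fun C => (C.supp.ncard - 2 : ℤ) ^ 2) (fun C => C.supp.ncard - 2) := by
  rw [CNSL, CNRS, funext hΓ.sum_CN, hΓ.CN_eq_fiberBlockMatrix]
  ext i j
  simp only [fiberBlockMatrix, Matrix.add_apply, diagonal_apply, of_apply]
  split_ifs <;> ring

theorem isCNLIntegral (hΓ : IsClusterGraph Γ) : IsCNLIntegral Γ := by
  classical
  rw [IsCNLIntegral, CNLSpec, hΓ.CNL_eq_fiberBlockMatrix]
  exact exists_int_of_mem_specWithMult_fiberBlockMatrix _ _ _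

theorem isCNSLIntegral (hΓ : IsClusterGraph Γ) : IsCNSLIntegral Γ := by
  classical
  rw [IsCNSLIntegral, CNSLSpec, hΓ.CNSL_eq_fiberBlockMatrix]
  exact exists_int_of_mem_specWithMult_fiberBlockMatrix _ _ _

end IsClusterGraph

end ClusterGraph

section ACGroup

variable {G : Type*} [Group G]

theorem CCCVertex.notMem_center {C : CCCVertex G} {x : G} (hx : x ∈ C.1.carrier) :
    x ∉ Subgroup.center G := by
  obtain ⟨y, hy, hyC⟩ := C.2
  rw [← hyC, ConjClasses.mem_carrier_iff_mk_eq, ConjClasses.mk_eq_mk_iff_isConj] at hx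
  obtain ⟨g, rfl⟩ := isConj_iff.mp hx
  exact fun hmem => hy (Subgroup.Normal.conj_mem inferInstance x hmem g)

theorem CCCGraph.exists_commute_of_adj {C D : CCCVertex G} (h : (CCCGraph G).Adj C D) {x : G}
    (hx : x ∈ C.1.carrier) : ∃ y ∈ D.1.carrier, Commute x y := by
  obtain ⟨-, x', hx', y, hy, hxy⟩ := h
  rw [ConjClasses.mem_carrier_iff_mk_eq] at hx hx' hy
  obtain ⟨g, rfl⟩ := isConj_iff.mp (ConjClasses.mk_eq_mk_iff_isConj.mp (hx'.trans hx.symm))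
  refine ⟨g * y * g⁻¹, ?_, (Commute.conj_iff g).mpr hxy⟩
  rw [ConjClasses.mem_carrier_iff_mk_eq, ← hy, ConjClasses.mk_eq_mk_iff_isConj]
  exact (isConj_iff.mpr ⟨g, rfl⟩).symm

/-- An AC-group is a group in which the centralizer of every non-central element is abelian;
equivalently, commutation is a transitive relation on the non-central elements. Abelian groups are
included. -/
def IsACGroup (G : Type*) [Group G] : Prop :=
  ∀ x ∉ Subgroup.center G, IsMulCommutative (Subgroup.centralizer {x})

namespace IsACGroup

theorem commute_trans (hG : IsACGroup G) {x y z : G} (hy : y ∉ Subgroup.center G)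
    (hxy : Commute x y) (hyz : Commute y z) : Commute x z :=
  have := hG y hy
  setLike_mul_comm (s := Subgroup.centralizer {y})
    (Subgroup.mem_centralizer_singleton_iff.mpr hxy.eq)
    (Subgroup.mem_centralizer_singleton_iff.mpr hyz.symm.eq)

theorem isClusterGraph_CCCGraph (hG : IsACGroup G) : IsClusterGraph (CCCGraph G) := by
  refine isClusterGraph_of_adj_trans fun C D E hCD hDE hCE => ?_
  obtain ⟨y, -, hyD⟩ := D.2
  have hy : y ∈ D.1.carrier := ConjClasses.mem_carrier_iff_mk_eq.mpr hyD
  obtain ⟨x, hx, hyx⟩ := CCCGraph.exists_commute_of_adj hCD.symm hy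
  obtain ⟨z, hz, hyz⟩ := CCCGraph.exists_commute_of_adj hDE hy
  exact ⟨hCE, x, hx, z, hz, hG.commute_trans (CCCVertex.notMem_center hy) hyx.symm hyz⟩

theorem of_mulEquiv {H : Type*} [Group H] (e : G ≃* H) (hH : IsACGroup H) : IsACGroup G := by
  intro y hy
  have hey : e y ∉ Subgroup.center H := fun hmem =>
    hy (Subgroup.mem_center_iff.mpr fun g =>
      e.injective (by simpa using Subgroup.mem_center_iff.mp hmem (e g)))
  refine .of_setLike_mul_comm fun x hx z hz => e.injective ?_
  rw [Subgroup.mem_centralizer_singleton_iff] at hx hz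
  rw [map_mul, map_mul]
  exact hH.commute_trans hey (Commute.map hx e) (Commute.map hz e).symm

end IsACGroup

end ACGroup

section AbelianNormalSubgroup

variable {G : Type*} [Group G]

theorem eq_or_eq_top_of_index_dvd_prime {A B : Subgroup G} {p : ℕ} (hp : p.Prime)
    (hA : A.index ∣ p) (hAB : A ≤ B) : B = A ∨ B = ⊤ := by
  rw [← Subgroup.relIndex_mul_index hAB] at hA
  obtain hB | hB := (Nat.dvd_prime hp).mp ((dvd_mul_left ..).trans hA)
  · exact .inr (Subgroup.index_eq_one.mp hB)
  · refine .inl (le_antisymm (Subgroup.relIndex_eq_one.mp ?_) hAB)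
    rw [hB] at hA
    exact Nat.dvd_one.mp (Nat.dvd_of_mul_dvd_mul_right hp.pos (by rwa [one_mul]))

theorem centralizer_eq_or_mem_center {A : Subgroup G} [IsMulCommutative A] {p : ℕ}
    (hp : p.Prime) (hA : A.index ∣ p) {a : G} (ha : a ∈ A) :
    Subgroup.centralizer {a} = A ∨ a ∈ Subgroup.center G := by
  refine (eq_or_eq_top_of_index_dvd_prime hp hA fun b hb => ?_).imp_right fun htop => ?_
  · exact Subgroup.mem_centralizer_singleton_iff.mpr (setLike_mul_comm hb ha)
  · simpa using htop

/-- If `x ∉ A`, then elements of `A` commuting with `x` are central, since their centralizers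
contain `A` properly; so the centralizer of `x` is abelian, being cyclic modulo central elements. -/
theorem isACGroup_of_index_dvd_prime (A : Subgroup G) [A.Normal] [IsMulCommutative A] {p : ℕ}
    (hp : p.Prime) (hA : A.index ∣ p) : IsACGroup G := by
  intro x hx
  by_cases hxA : x ∈ A
  · rwa [(centralizer_eq_or_mem_center hp hA hxA).resolve_right hx]
  have : Fact p.Prime := ⟨hp⟩
  have : IsCyclic (G ⧸ A) := isCyclic_of_card_dvd_prime hA
  let φ := (QuotientGroup.mk' A).comp (Subgroup.centralizer {x}).subtype
  refine φ.isMulCommutative_of_isCyclic_of_ker_le_center fun a ha => ?_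
  have haA : (a : G) ∈ A := (QuotientGroup.eq_one_iff (a : G)).mp ha
  have hax := Subgroup.mem_centralizer_singleton_iff.mp a.2
  have hcenter : (a : G) ∈ Subgroup.center G := by
    refine (centralizer_eq_or_mem_center hp hA haA).resolve_left fun hEq => hxA ?_
    exact hEq ▸ Subgroup.mem_centralizer_singleton_iff.mpr hax.symm
  exact Subgroup.mem_center_iff.mpr fun g => Subtype.ext (Subgroup.mem_center_iff.mp hcenter g)

theorem isMulCommutative_comap_of_ker_le_center {H : Type*} [Group H] {f : G →* H}
    (hf : f.ker ≤ Subgroup.center G) (B : Subgroup H) [IsCyclic B] :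
    IsMulCommutative (B.comap f) := by
  refine (f.subgroupComap B).isMulCommutative_of_isCyclic_of_ker_le_center fun k hk => ?_
  have hk' : (k : G) ∈ f.ker := congrArg Subtype.val (MonoidHom.mem_ker.mp hk)
  exact Subgroup.mem_center_iff.mpr fun g => Subtype.ext (Subgroup.mem_center_iff.mp (hf hk') g)

theorem isACGroup_of_mulEquiv_quotient_center {H : Type*} [Group H]
    (e : G ⧸ Subgroup.center G ≃* H) (B : Subgroup H) [B.Normal] [IsCyclic B] {p : ℕ}
    (hp : p.Prime) (hB : B.index ∣ p) : IsACGroup G := by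
  let f := e.toMonoidHom.comp (QuotientGroup.mk' (Subgroup.center G))
  have hf : f.ker ≤ Subgroup.center G := fun g hg =>
    (QuotientGroup.eq_one_iff g).mp (e.map_eq_one_iff.mp hg)
  have := isMulCommutative_comap_of_ker_le_center hf B
  refine isACGroup_of_index_dvd_prime (B.comap f) hp ?_
  rwa [Subgroup.index_comap_of_surjective B
    (e.surjective.comp (QuotientGroup.mk'_surjective _))]

theorem isACGroup_of_mulEquiv_quotient_center_prod {H K : Type*} [Group H] [Group K] [IsCyclic H]
    (e : G ⧸ Subgroup.center G ≃* H × K) {p : ℕ} (hp : p.Prime) (hK : Nat.card K ∣ p) :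
    IsACGroup G := by
  let B := (MonoidHom.snd H K).ker
  have hB : B.index = Nat.card K := by
    rw [Subgroup.index_ker, MonoidHom.range_eq_top.mpr Prod.snd_surjective, Subgroup.card_top]
  have : IsCyclic B := isCyclic_of_injective ((MonoidHom.fst H K).comp B.subtype) fun a b hab =>
    Subtype.ext (Prod.ext hab (a.2.trans b.2.symm))
  exact isACGroup_of_mulEquiv_quotient_center e B hp (hB ▸ hK)

theorem mem_normalizer_of_pow_mem {A : Subgroup G} {t : G} {n : ℕ} (hn : n ≠ 0) (ht : t ^ n ∈ A)
    (hconj : ∀ a ∈ A, t⁻¹ * a * t ∈ A) : t ∈ Subgroup.normalizer (A : Set G) := by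
  have hpow (k : ℕ) : ∀ a ∈ A, (t ^ k)⁻¹ * a * t ^ k ∈ A := by
    induction k with
    | zero => simp
    | succ k ih =>
      intro a ha
      simpa [pow_succ, mul_assoc] using hconj _ (ih a ha)
  obtain ⟨m, rfl⟩ := Nat.exists_eq_succ_of_ne_zero hn
  refine Subgroup.mem_normalizer_iff.mpr fun a => ⟨fun ha => ?_, fun ha => ?_⟩
  · have h := hpow m _ (A.mul_mem (A.mul_mem ht ha) (A.inv_mem ht))
    convert h using 1
    rw [pow_succ]
    group
  · simpa [mul_assoc] using hconj _ ha

theorem index_dvd_of_closure_insert_eq_top {A : Subgroup G} [A.Normal] {t : G} {n : ℕ}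
    (ht : t ^ n ∈ A) (hgen : Subgroup.closure (insert t (A : Set G)) = ⊤) : A.index ∣ n := by
  have hle : Subgroup.closure (insert t (A : Set G)) ≤
      (Subgroup.zpowers (t : G ⧸ A)).comap (QuotientGroup.mk' A) := by
    refine (Subgroup.closure_le _).mpr (Set.insert_subset (Subgroup.mem_zpowers _) fun a ha => ?_)
    have ha1 : QuotientGroup.mk' A a = 1 := (QuotientGroup.eq_one_iff a).mpr ha
    rw [SetLike.mem_coe, Subgroup.mem_comap, ha1]
    exact one_mem _
  have hcyclic (q : G ⧸ A) : q ∈ Subgroup.zpowers (t : G ⧸ A) := by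
    obtain ⟨g, rfl⟩ := QuotientGroup.mk'_surjective A q
    exact hle (hgen ▸ Subgroup.mem_top g)
  rw [Subgroup.index, ← orderOf_eq_card_of_forall_mem_zpowers hcyclic]
  exact orderOf_dvd_of_pow_eq_one ((QuotientGroup.eq_one_iff (t ^ n)).mpr ht)

theorem isACGroup_of_closure_insert_eq_top {S : Set G} {t : G} {p : ℕ} (hp : p.Prime)
    (hS : ∀ a ∈ S, ∀ b ∈ S, a * b = b * a) (ht : t ^ p ∈ Subgroup.closure S)
    (hconj : ∀ a ∈ S, t⁻¹ * a * t ∈ Subgroup.closure S)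
    (hgen : Subgroup.closure (insert t S) = ⊤) : IsACGroup G := by
  let A := Subgroup.closure S
  have hSA : S ⊆ A := Subgroup.subset_closure
  have hle : A ≤ A.comap (MulAut.conj t⁻¹).toMonoidHom :=
    (Subgroup.closure_le _).mpr fun a ha => by simpa using hconj a ha
  have htA : t ∈ Subgroup.normalizer (A : Set G) :=
    mem_normalizer_of_pow_mem hp.ne_zero ht fun a ha => by simpa using hle ha
  have : A.Normal := Subgroup.normalizer_eq_top_iff.mp <| top_le_iff.mp <| hgen ▸
    (Subgroup.closure_le _).mpr (Set.insert_subset htA (hSA.trans Subgroup.le_normalizer))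
  have : IsMulCommutative A := Subgroup.isMulCommutative_closure hS
  refine isACGroup_of_index_dvd_prime A hp (index_dvd_of_closure_insert_eq_top ht ?_)
  exact top_le_iff.mp (hgen ▸ Subgroup.closure_mono (Set.insert_subset_insert hSA))

end AbelianNormalSubgroup

section GroupFamilies

theorem dihedralGroup_index_zpowers_r_one (n : ℕ) :
    (Subgroup.zpowers (DihedralGroup.r 1 : DihedralGroup n)).index = 2 := by
  have hr (i : ZMod n) : DihedralGroup.r i ∈ Subgroup.zpowers (DihedralGroup.r 1) := by
    obtain ⟨k, rfl⟩ := ZMod.intCast_surjective i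
    exact ⟨k, DihedralGroup.r_one_zpow k⟩
  have hsr (i : ZMod n) : DihedralGroup.sr i ∉ Subgroup.zpowers (DihedralGroup.r 1) := by
    simp [Subgroup.mem_zpowers_iff]
  refine Subgroup.index_eq_two_iff.mpr ⟨.sr 0, ?_⟩
  rintro (i | i) <;> simp [hr, hsr]

theorem isACGroup_dihedralGroup (n : ℕ) : IsACGroup (DihedralGroup n) :=
  have := Subgroup.normal_of_index_eq_two (dihedralGroup_index_zpowers_r_one n)
  isACGroup_of_index_dvd_prime _ Nat.prime_two (dihedralGroup_index_zpowers_r_one n).dvd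

theorem isACGroup_quaternionGroup (n : ℕ) : IsACGroup (QuaternionGroup n) := by
  let aHom : Multiplicative (ZMod (2 * n)) →* QuaternionGroup n :=
    .mk' (fun i => .a i.toAdd) fun i j => (QuaternionGroup.a_mul_a i.toAdd j.toAdd).symm
  have ha (i : ZMod (2 * n)) : QuaternionGroup.a i ∈ aHom.range := ⟨.ofAdd i, rfl⟩
  have hxa (i : ZMod (2 * n)) : QuaternionGroup.xa i ∉ aHom.range := by simp [aHom]
  have hindex : aHom.range.index = 2 := by
    refine Subgroup.index_eq_two_iff.mpr ⟨.xa 0, ?_⟩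
    rintro (i | i) <;> simp [ha, hxa, -MonoidHom.mem_range]
  have := Subgroup.normal_of_index_eq_two hindex
  exact isACGroup_of_index_dvd_prime _ Nat.prime_two hindex.dvd

variable {G : Type*} [Group G]

theorem isACGroup_of_quotient_center_mulEquiv_dihedralGroup {n : ℕ}
    (e : G ⧸ Subgroup.center G ≃* DihedralGroup n) : IsACGroup G :=
  have := Subgroup.normal_of_index_eq_two (dihedralGroup_index_zpowers_r_one n)
  isACGroup_of_mulEquiv_quotient_center e (.zpowers (.r 1)) Nat.prime_two
    (dihedralGroup_index_zpowers_r_one n).dvd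

variable {x y : G}

theorem isACGroup_of_inv_mul_mul_eq_inv (hgen : Subgroup.closure {x, y} = ⊤)
    (hxy : x⁻¹ * y * x = y⁻¹) : IsACGroup G := by
  have hsq : x ^ 2 * y = y * x ^ 2 := by
    have hyx : y * x = x * y⁻¹ := by rw [← hxy]; group
    have hyx' : y⁻¹ * x = x * y := by
      rw [inv_mul_eq_iff_eq_mul, ← mul_assoc, hyx, inv_mul_cancel_right]
    calc x ^ 2 * y = x * (x * y) := by rw [sq, mul_assoc]
      _ = x * y⁻¹ * x := by rw [← hyx', mul_assoc]
      _ = y * x ^ 2 := by rw [← hyx, mul_assoc, sq]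
  have hx : x ^ 2 ∈ Subgroup.closure {x ^ 2, y} := Subgroup.subset_closure (by simp)
  have hy : y ∈ Subgroup.closure {x ^ 2, y} := Subgroup.subset_closure (by simp)
  refine isACGroup_of_closure_insert_eq_top (S := {x ^ 2, y}) (t := x) Nat.prime_two ?_ hx ?_ ?_
  · rintro a (rfl | rfl) b (rfl | rfl)
    exacts [rfl, hsq, hsq.symm, rfl]
  · rintro a (rfl | rfl)
    · simpa [sq, mul_assoc] using hx
    · exact hxy ▸ inv_mem hy
  · exact top_le_iff.mp (hgen ▸ Subgroup.closure_mono (by grind))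

theorem isACGroup_of_mul_mul_eq_zpow (hgen : Subgroup.closure {x, y} = ⊤) (hy : y ^ 2 = 1) {k : ℤ}
    (hxy : y * x * y = x ^ k) : IsACGroup G := by
  refine isACGroup_of_closure_insert_eq_top (S := {x}) (t := y) Nat.prime_two ?_ ?_ ?_ ?_
  · rintro a rfl b rfl
    rfl
  · exact hy ▸ one_mem _
  · rintro a rfl
    rw [inv_eq_of_mul_eq_one_left (sq y ▸ hy), hxy]
    exact zpow_mem (Subgroup.mem_closure_singleton_self a) k
  · rwa [Set.pair_comm]

theorem isACGroup_of_mul_eq_inv_mul_inv (hgen : Subgroup.closure {x, y} = ⊤) (hy : y ^ 4 = 1)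
    (h : y * x = x⁻¹ * y⁻¹) (h' : y⁻¹ * x = x⁻¹ * y) : IsACGroup G := by
  have hsq : x * y ^ 2 = y ^ 2 * x := by
    have hconj : y * x * y = y⁻¹ * x * y⁻¹ := by
      rw [h, h', inv_mul_cancel_right, mul_inv_cancel_right]
    calc x * y ^ 2 = y ^ 4 * x * y ^ 2 := by rw [hy, one_mul]
      _ = y ^ 3 * (y * x * y) * y := by simp only [pow_succ, pow_zero, one_mul, mul_assoc]
      _ = y ^ 2 * x := by rw [hconj]; simp only [pow_succ, pow_zero, one_mul]; group
  have hxS : x ∈ Subgroup.closure {x, y ^ 2} := Subgroup.subset_closure (by simp)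
  have hyS : y ^ 2 ∈ Subgroup.closure {x, y ^ 2} := Subgroup.subset_closure (by simp)
  refine isACGroup_of_closure_insert_eq_top (S := {x, y ^ 2}) (t := y) Nat.prime_two ?_ hyS ?_ ?_
  · rintro a (rfl | rfl) b (rfl | rfl)
    exacts [rfl, hsq, hsq.symm, rfl]
  · rintro a (rfl | rfl)
    · rw [h', mul_assoc, ← sq]
      exact mul_mem (inv_mem hxS) hyS
    · simpa [sq, mul_assoc] using hyS
  · exact top_le_iff.mp (hgen ▸ Subgroup.closure_mono (by grind))

theorem closure_mk_genX_mk_genY_eq_top (rels : Set (FreeGroup (Fin 2))) :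
    Subgroup.closure {PresentedGroup.mk rels genX, PresentedGroup.mk rels genY} = ⊤ := by
  have hrange : Set.range (PresentedGroup.of (rels := rels)) =
      {PresentedGroup.mk rels genX, PresentedGroup.mk rels genY} := by
    ext g
    simp only [Set.mem_range, Fin.exists_fin_two, Set.mem_insert_iff, Set.mem_singleton_iff,
      eq_comm (a := g)]
    rfl
  rw [← hrange, PresentedGroup.closure_range_of]

theorem isACGroup_groupU (n m : ℕ) : IsACGroup (GroupU n m) :=
  isACGroup_of_inv_mul_mul_eq_inv (closure_mk_genX_mk_genY_eq_top _)
    (PresentedGroup.mk_eq_mk_of_mul_inv_mem (by simp))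

theorem isACGroup_groupSD (n : ℕ) : IsACGroup (GroupSD n) :=
  isACGroup_of_mul_mul_eq_zpow (closure_mk_genX_mk_genY_eq_top _)
    (PresentedGroup.one_of_mem (x := genY ^ 2) (by simp))
    (PresentedGroup.mk_eq_mk_of_mul_inv_mem (x := genY * genX * genY)
      (y := genX ^ (2 * (n : ℤ) - 1)) (by simp))

theorem isACGroup_groupV (n : ℕ) : IsACGroup (GroupV n) :=
  isACGroup_of_mul_eq_inv_mul_inv (closure_mk_genX_mk_genY_eq_top _)
    (PresentedGroup.one_of_mem (x := genY ^ 4) (by simp))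
    (PresentedGroup.mk_eq_mk_of_mul_inv_mem (x := genY * genX) (y := genX⁻¹ * genY⁻¹) (by simp))
    (PresentedGroup.mk_eq_mk_of_mul_inv_mem (x := genY⁻¹ * genX) (y := genX⁻¹ * genY) (by simp))

end GroupFamilies

theorem mainTheorem8 (G : Type*) [Group G] [Finite G]
    (hG : ¬ ∀ a b : G, a * b = b * a)
    (h :
      (∃ p : ℕ, p.Prime ∧
        Nonempty (G ⧸ Subgroup.center G ≃* Multiplicative (ZMod p) × Multiplicative (ZMod p))) ∨
      (∃ n : ℕ, 3 ≤ n ∧ Nonempty (G ⧸ Subgroup.center G ≃* DihedralGroup n)) ∨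
      (∃ n : ℕ, 3 ≤ n ∧ Nonempty (G ≃* DihedralGroup n)) ∨
      (∃ n : ℕ, 2 ≤ n ∧ Nonempty (G ≃* QuaternionGroup n)) ∨
      (∃ n : ℕ, 2 ≤ n ∧ Nonempty (G ≃* GroupUSix n)) ∨
      (∃ n m : ℕ, 2 ≤ n ∧ 2 ≤ m ∧ Nonempty (G ≃* GroupU n m)) ∨
      (∃ n : ℕ, 2 ≤ n ∧ Nonempty (G ≃* GroupSD n)) ∨
      (∃ n : ℕ, 2 ≤ n ∧ Nonempty (G ≃* GroupV n))) :
    IsCNLIntegral (CCCGraph G) ∧ IsCNSLIntegral (CCCGraph G) := by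
  suffices hAC : IsACGroup G from
    ⟨hAC.isClusterGraph_CCCGraph.isCNLIntegral, hAC.isClusterGraph_CCCGraph.isCNSLIntegral⟩
  obtain ⟨p, hp, ⟨e⟩⟩ | ⟨n, -, ⟨e⟩⟩ | ⟨n, -, ⟨e⟩⟩ | ⟨n, -, ⟨e⟩⟩ | ⟨n, -, ⟨e⟩⟩ |
    ⟨n, m, -, -, ⟨e⟩⟩ | ⟨n, -, ⟨e⟩⟩ | ⟨n, -, ⟨e⟩⟩ := h
  · exact isACGroup_of_mulEquiv_quotient_center_prod e hp (Nat.card_zmod p).dvd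
  · exact isACGroup_of_quotient_center_mulEquiv_dihedralGroup e
  · exact (isACGroup_dihedralGroup n).of_mulEquiv e
  · exact (isACGroup_quaternionGroup n).of_mulEquiv e
  · exact (isACGroup_groupU n 3).of_mulEquiv e
  · exact (isACGroup_groupU n m).of_mulEquiv e
  · exact (isACGroup_groupSD n).of_mulEquiv e
  · exact (isACGroup_groupV n).of_mulEquiv e
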